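/- Let $d\ge 0$, let $\mathcal Y\subset\mathbb R$ be compact, and let $\mathcal H\subset C^2(\mathbb R^d,\mathcal Y)$ be a set of twice continuously differentiable functions $\psi:\mathbb R^d\to\mathbb R$ with values in $\mathcal Y$. Put $\mathcal Z=\mathbb R^d\times\mathcal Y$, let $\ell((x,y),\psi)=(y-\psi(x))^2$ be the quadratic loss, and $C_\ell=\sup_{z\in\mathcal Z,\psi\in\mathcal H}\ell(z,\psi)$. Assume that $\mathcal H$ has finite VC dimension under $\ell$, i.e. the class $\mathcal A$ of the sets $\{z\in\mathcal Z:\ell(z,\psi)>b\}$, $\psi\in\mathcal H$, $0<b<C_\ell$, has finite VC dimension: there are only finitely many $n$ for which $\sup_{z_1,\dots,z_n\in\mathcal Z}\#\{(\mathbf 1\{z_1\in A\},\dots,\mathbf 1\{z_n\in A\}):A\in\mathcal A\}=2^n$. Assume moreover that, for all $i,j=1,\dots,d$, $$\sup_{x\in\mathbb R^d,\ \psi\in\mathcal H}\left|\frac{\partial\psi}{\partial x_i}(x)\right|<\infty\quad\text{and}\quad \sup_{x\in\mathbb R^d,\ \psi\in\mathcal H}\left|\frac{\partial^2\psi}{\partial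 x_i\partial x_j}(x)\right|<\infty .$$ Let $Z_i=(X_i,Y_i)$, $i\ge1$, be i.i.d. $\mathcal Z$-valued random vectors with arbitrary law $\nu$, and $S_n=(Z_1,\dots,Z_n)$. For each $n$ let $\Psi_n:\mathcal Z^n\to\mathcal H$ be a prediction rule, $\psi_n=\Psi_n(S_n)$, and for all $x\in\mathbb R^d$, $y\in\mathcal Y$, $\psi\in\mathcal H$ and $s\in\mathcal Z^n$ let $K_{x,y,\psi,s}$ be a positive semidefinite $d\times d$ matrix. Suppose that with probability one $$\lim_{n\to\infty}\ \sup_{x\in\mathbb R^d,\,y\in\mathcal Y,\,\psi\in\mathcal H}[K_{x,y,\psi,S_n}]_{j,j}=0\qquad\text{for all }j=1,\dots,d.$$ Then the Gaussian bolstering error estimator $$\hat\varepsilon_n^{gbr}=\frac1n\sum_{i=1}^n\int_{\mathbb R^d}\left[\psi_n(x)-Y_i\right]^2\,dN(X_i,K_{X_i,Y_i,\psi_n,S_n})(x),$$ where $N(m,K)$ is the (possibly degenerate) Gaussian measure on $\mathbb R^d$ with mean $m$ and covariance matrix $K$, is consistent: with probability one $|\hat\varepsilon_n^{gbr}-\varepsilon_n|\to0$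 as $n\to\infty$, where $\varepsilon_n=\int_{\mathcal Z}(y-\psi_n(x))^2\,d\nu(x,y)$. -/

import Mathlib

open MeasureTheory ProbabilityTheory Filter Topology
open scoped ENNReal

namespace Bolstering

noncomputable section

/-- The `n`-th shatter coefficient of a class `𝒜` of subsets of `Z`: the largest number of
patterns `(1{z₁ ∈ A}, …, 1{zₙ ∈ A})`, `A ∈ 𝒜`, over all choices of points `z₁, …, zₙ`. -/
def shatterCoeff {Z : Type*} (𝒜 : Set (Set Z)) (n : ℕ) : ℕ∞ :=
  ⨆ z : Fin n → Z, Set.encard {v : Fin n → Prop | ∃ A ∈ 𝒜, v = fun i => z i ∈ A}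

/-- The VC dimension of a class of sets: the greatest `n` whose shatter coefficient is `2 ^ n`
(`⊤` if there are arbitrarily large such `n`). -/
def vcDim {Z : Type*} (𝒜 : Set (Set Z)) : ℕ∞ :=
  ⨆ n ∈ {n : ℕ | shatterCoeff 𝒜 n = 2 ^ n}, (n : ℕ∞)

/-- `C_ℓ = sup ℓ(z, ψ)`, possibly infinite, for a nonnegative loss `ℓ` on `Z × H`. -/
def lossSup {Z H : Type*} (ℓ : Z → H → ℝ) : ℝ≥0∞ :=
  ⨆ (z : Z) (ψ : H), ENNReal.ofReal (ℓ z ψ)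

/-- The class of the sets `{z : ℓ(z, ψ) > b}` for `ψ ∈ H` and `b ∈ (0, C_ℓ)`. -/
def lossLevelSets {Z H : Type*} (ℓ : Z → H → ℝ) : Set (Set Z) :=
  {A | ∃ (ψ : H) (b : ℝ), 0 < b ∧ ENNReal.ofReal b < lossSup ℓ ∧ A = {z | b < ℓ z ψ}}

/-- The VC dimension of a hypothesis space `H` under the loss `ℓ`. -/
def vcDimLoss {Z H : Type*} (ℓ : Z → H → ℝ) : ℕ∞ :=
  vcDim (lossLevelSets ℓ)

/-- The feature space `ℝ^d`. -/
abbrev Feature (d : ℕ) : Type := EuclideanSpace ℝ (Fin d)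

/-- The space `ℝ^d × 𝒴` of the data points `(x, y)`. -/
abbrev DataPoint (d : ℕ) (𝒴 : Set ℝ) : Type := Feature d × 𝒴

/-- The quadratic loss `ℓ((x, y), ψ) = (y - ψ(x))²`. -/
def quadraticLoss {d : ℕ} (𝒴 : Set ℝ) (H : Set (Feature d → ℝ)) (z : DataPoint d 𝒴) (ψ : H) : ℝ :=
  ((z.2 : ℝ) - ψ.1 z.1) ^ 2

/-- The partial derivative `∂f/∂x_i`. -/
def partialDeriv {d : ℕ} (i : Fin d) (f : Feature d → ℝ) (x : Feature d) : ℝ :=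
  fderiv ℝ f x (EuclideanSpace.single i 1)

/-- The error `L(ψ) = ∫ ℓ(z, ψ) dν(z)` of a hypothesis under the quadratic loss. -/
def predictionError {d : ℕ} {𝒴 : Set ℝ} {H : Set (Feature d → ℝ)}
    (ν : Measure (DataPoint d 𝒴)) (ψ : H) : ℝ :=
  ∫ z, quadraticLoss 𝒴 H z ψ ∂ν

/-- A prediction rule: for each sample size `n`, a map from samples to hypotheses. -/
abbrev PredictionRule {d : ℕ} (𝒴 : Set ℝ) (H : Set (Feature d → ℝ)) : Type :=
  (n : ℕ) → (Fin n → DataPoint d 𝒴) → H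

/-- The matrices `K_{x,y,ψ,S}`, indexed by the sample size, the sample `S`, `x`, `y` and `ψ`. -/
abbrev KernelFamily {d : ℕ} (𝒴 : Set ℝ) (H : Set (Feature d → ℝ)) : Type :=
  (n : ℕ) → (Fin n → DataPoint d 𝒴) → Feature d → 𝒴 → H → Matrix (Fin d) (Fin d) ℝ

/-- The Gaussian bolstering error estimator of `ψ` on the sample `S`:
`(1/n) ∑ᵢ ∫ (ψ(x) - yᵢ)² dN(xᵢ, K_{xᵢ,yᵢ,ψ,S})(x)`. -/
def gaussianBolstering {d : ℕ} {𝒴 : Set ℝ} {H : Set (Feature d → ℝ)} (K : KernelFamily 𝒴 H)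
    {n : ℕ} (S : Fin n → DataPoint d 𝒴) (ψ : H) : ℝ :=
  (1 / (n : ℝ)) * ∑ i : Fin n,
    ∫ x, (ψ.1 x - ((S i).2 : ℝ)) ^ 2 ∂(multivariateGaussian (S i).1 (K n S (S i).1 (S i).2 ψ))

/-- The sample `S_n(ω)` made of the first `n` data points. -/
def sample {Ω Z : Type*} (D : ℕ → Ω → Z) (n : ℕ) (ω : Ω) : Fin n → Z :=
  fun i => D i ω

/-- An estimator sequence `est` of the random errors `err` is consistent if
`|est_n - err_n| → 0` with probability one. -/
def IsConsistent {Ω : Type*} [MeasurableSpace Ω] (P : Measure Ω) (est err : ℕ → Ω → ℝ) : Prop :=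
  ∀ᵐ ω ∂P, Tendsto (fun n => |est n ω - err n ω|) atTop (𝓝 0)

end

end Bolstering

/-!
Two facts give the uniform convergence of the bolstered errors to the true errors over all of `H`.

* The losses `ℓ(·, ψ)` form a bounded equicontinuous family on a Lindelöf space, so they obey a
  uniform strong law of large numbers (Ranga Rao): outside a set carrying little of the integral of
  an envelope, finitely many measurable pieces have small oscillation for all `ψ` at once, and the
  ordinary strong law applied to these pieces and to the error term controls the whole family.
* Uniform equicontinuity and boundedness give a bound `|ψ x - ψ m| ≤ a + b ‖x - m‖²` with `a`
  arbitrarily small and `b` independent of `ψ`. Under `N(m, K)` the right-hand side integrates to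
  `a + b tr K`, so smoothing by a Gaussian with small covariance moves the losses uniformly little.
-/

namespace Bolstering

open scoped NNReal

section EmpiricalMean

variable {Z : Type*} {n : ℕ}

/-- The mean of `g` under the empirical measure of the sample `S`; it is `0` for the empty
sample. -/
noncomputable def empiricalMean (S : Fin n → Z) (g : Z → ℝ) : ℝ :=
  (∑ i, g (S i)) / n

theorem empiricalMean_sub (S : Fin n → Z) (f g : Z → ℝ) :
    empiricalMean S (fun z => f z - g z) = empiricalMean S f - empiricalMean S g := by
  simp only [empiricalMean, Finset.sum_sub_distrib, sub_div]

theorem empiricalMean_sum_mul {ι : Type*} (S : Fin n → Z) (t : Finset ι) (a : ι → ℝ)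
    (φ : ι → Z → ℝ) :
    empiricalMean S (fun z => ∑ k ∈ t, a k * φ k z) = ∑ k ∈ t, a k * empiricalMean S (φ k) := by
  simp only [empiricalMean]
  rw [Finset.sum_comm, Finset.sum_div]
  simp only [← Finset.mul_sum, mul_div_assoc]

theorem abs_empiricalMean_sub_le {f g b : Z → ℝ} (S : Fin n → Z)
    (h : ∀ z, |f z - g z| ≤ b z) :
    |empiricalMean S f - empiricalMean S g| ≤ empiricalMean S b := by
  rw [← empiricalMean_sub, empiricalMean, abs_div, Nat.abs_cast]
  exact div_le_div_of_nonneg_right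
    ((Finset.abs_sum_le_sum_abs _ _).trans (Finset.sum_le_sum fun i _ => h (S i))) n.cast_nonneg

theorem empiricalMean_le {g : Z → ℝ} {C : ℝ} (S : Fin n → Z) (hC : 0 ≤ C) (h : ∀ z, g z ≤ C) :
    empiricalMean S g ≤ C := by
  refine div_le_of_le_mul₀ n.cast_nonneg hC ?_
  calc ∑ i, g (S i) ≤ ∑ _i : Fin n, C := Finset.sum_le_sum fun i _ => h (S i)
    _ = C * n := by simp [mul_comm]

theorem abs_empiricalMean_sub_integral_le [MeasurableSpace Z] {ν : Measure Z} {ι : Type*}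
    {t : Finset ι} {f b : Z → ℝ} {a : ι → ℝ} {φ : ι → Z → ℝ} (hf : Integrable f ν)
    (hφ : ∀ k ∈ t, Integrable (φ k) ν) (hb : Integrable b ν)
    (h : ∀ z, |f z - ∑ k ∈ t, a k * φ k z| ≤ b z) (S : Fin n → Z) :
    |empiricalMean S f - ∫ z, f z ∂ν| ≤ empiricalMean S b + ∫ z, b z ∂ν
      + ∑ k ∈ t, |a k| * |empiricalMean S (φ k) - ∫ z, φ k z ∂ν| := by
  set g : Z → ℝ := fun z => ∑ k ∈ t, a k * φ k z
  have hg : Integrable g ν := integrable_finsetSum _ fun k hk => (hφ k hk).const_mul _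
  have h_emp : |empiricalMean S f - empiricalMean S g| ≤ empiricalMean S b :=
    abs_empiricalMean_sub_le S h
  have h_int : |∫ z, g z ∂ν - ∫ z, f z ∂ν| ≤ ∫ z, b z ∂ν := by
    rw [abs_sub_comm, ← integral_sub hf hg, ← Real.norm_eq_abs]
    exact norm_integral_le_of_norm_le hb (.of_forall h)
  have h_lin : |empiricalMean S g - ∫ z, g z ∂ν|
      ≤ ∑ k ∈ t, |a k| * |empiricalMean S (φ k) - ∫ z, φ k z ∂ν| := by
    rw [empiricalMean_sum_mul, integral_finsetSum _ fun k hk => (hφ k hk).const_mul _]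
    simp only [integral_const_mul, ← Finset.sum_sub_distrib, ← mul_sub, ← abs_mul]
    exact Finset.abs_sum_le_sum_abs _ _
  linarith [abs_sub_le (empiricalMean S f) (empiricalMean S g) (∫ z, f z ∂ν),
    abs_sub_le (empiricalMean S g) (∫ z, g z ∂ν) (∫ z, f z ∂ν)]

end EmpiricalMean

section UniformStrongLaw

variable {Ω Z ι : Type*} [MeasurableSpace Ω] [MeasurableSpace Z] {P : Measure Ω} {ν : Measure Z}
  {D : ℕ → Ω → Z}

theorem ae_tendsto_empiricalMean_sample (hlaw : ∀ i, HasLaw (D i) ν P)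
    (hindep : Pairwise fun i j => D i ⟂ᵢ[P] D j) {g : Z → ℝ} (hg : Integrable g ν) :
    ∀ᵐ ω ∂P, Tendsto (fun n => empiricalMean (sample D n ω) g) atTop (𝓝 (∫ z, g z ∂ν)) := by
  have hg_map (i : ℕ) : AEMeasurable g (P.map (D i)) := (hlaw i).map_eq ▸ hg.aemeasurable
  have hident (i : ℕ) : IdentDistrib (D i) (D 0) P P :=
    ⟨(hlaw i).aemeasurable, (hlaw 0).aemeasurable, by rw [(hlaw i).map_eq, (hlaw 0).map_eq]⟩
  have hint : Integrable (g ∘ D 0) P :=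
    ((hlaw 0).map_eq ▸ hg : Integrable g (P.map (D 0))).comp_aemeasurable (hlaw 0).aemeasurable
  have hslln := strong_law_ae_real (fun i => g ∘ D i) hint
    (fun i j hij => (hindep hij).comp₀ (hlaw i).aemeasurable (hlaw j).aemeasurable (hg_map i)
      (hg_map j))
    fun i => (hident i).comp_of_aemeasurable (hg_map i)
  rw [(hlaw 0).integral_comp hg.aestronglyMeasurable] at hslln
  simpa only [empiricalMean, sample, Function.comp_apply, Finset.sum_range] using hslln

theorem exists_partition_abs_sub_le_of_equicontinuous [TopologicalSpace Z] [LindelofSpace Z]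
    [OpensMeasurableSpace Z] [Nonempty Z] {F : ι → Z → ℝ} (hF : Equicontinuous F) {δ : ℝ}
    (hδ : 0 < δ) :
    ∃ (A : ℕ → Set Z) (c : ℕ → Z), (∀ k, MeasurableSet (A k)) ∧
      Pairwise (Function.onFun Disjoint A) ∧ ⋃ k, A k = Set.univ ∧
      ∀ k, ∀ z ∈ A k, ∀ i, |F i z - F i (c k)| ≤ δ := by
  let U (w : Z) : Set Z := {z | ∀ i, |F i z - F i w| ≤ δ}
  have hU (w : Z) : U w ∈ 𝓝 w := by
    filter_upwards [Metric.equicontinuousAt_iff_right.1 (hF w) δ hδ] with z hz i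
    rw [← Real.dist_eq, dist_comm]
    exact (hz i).le
  obtain ⟨t, ht_count, ht_cover⟩ := countable_cover_nhds_interior hU
  have ht_ne : t.Nonempty := by
    by_contra! ht
    simp [ht, Set.empty_ne_univ] at ht_cover
  obtain ⟨c, rfl⟩ := ht_count.exists_eq_range ht_ne
  refine ⟨disjointed fun k => interior (U (c k)), c,
    .disjointed fun k => isOpen_interior.measurableSet, disjoint_disjointed _, ?_,
    fun k z hz => interior_subset (disjointed_subset _ k hz)⟩
  rw [iUnion_disjointed, ← ht_cover, Set.biUnion_range]

theorem exists_sum_indicator_approx_of_equicontinuous [TopologicalSpace Z] [LindelofSpace Z]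
    [OpensMeasurableSpace Z] [Nonempty Z] [IsProbabilityMeasure ν] {F : ι → Z → ℝ} {G : Z → ℝ}
    (hF : Equicontinuous F) (hG : Integrable G ν) (hFG : ∀ i z, |F i z| ≤ G z) {ε : ℝ}
    (hε : 0 < ε) :
    ∃ (A : ℕ → Set Z) (c : ℕ → Z) (N : ℕ) (b : Z → ℝ), (∀ k, MeasurableSet (A k)) ∧
      Integrable b ν ∧ ∫ z, b z ∂ν < ε ∧
      ∀ i z, |F i z - ∑ k ∈ Finset.range N, F i (c k) * (A k).indicator 1 z| ≤ b z := by
  obtain ⟨A, c, hA, hdisj, hcover, hosc⟩ :=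
    exists_partition_abs_sub_le_of_equicontinuous hF (half_pos hε)
  have hsum : Tendsto (fun N => ∑ k ∈ Finset.range N, ∫ z in A k, G z ∂ν) atTop
      (𝓝 (∫ z, G z ∂ν)) := by
    have h := hasSum_integral_iUnion hA hdisj hG.integrableOn
    rw [hcover, setIntegral_univ] at h
    exact h.tendsto_sum_nat
  obtain ⟨N, hN⟩ := (hsum.eventually_const_lt (sub_lt_self _ (half_pos hε))).exists
  set B : Set Z := ⋃ k ∈ Finset.range N, A k
  have hB : MeasurableSet B := Finset.measurableSet_biUnion _ fun k _ => hA k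
  have hB_int : ∫ z in B, G z ∂ν = ∑ k ∈ Finset.range N, ∫ z in A k, G z ∂ν :=
    integral_biUnion_finset _ (fun k _ => hA k) (fun j _ k _ hjk => hdisj hjk)
      fun k _ => hG.integrableOn
  refine ⟨A, c, N, fun z => ε / 2 + Bᶜ.indicator G z, hA,
    (integrable_const _).add (hG.indicator hB.compl), ?_, fun i z => ?_⟩
  · rw [integral_add (integrable_const _) (hG.indicator hB.compl), integral_indicator hB.compl,
      setIntegral_compl hB hG, hB_int]
    simp only [integral_const, probReal_univ, one_smul]
    linarith
  · by_cases hz : z ∈ B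
    · obtain ⟨k, hk, hzk⟩ := Set.mem_iUnion₂.1 hz
      rw [Finset.sum_eq_single_of_mem k hk fun j _ hjk => by
        simp [(hdisj hjk).notMem_of_mem_right hzk]]
      simpa [hzk, hz] using hosc k z hzk i
    · have hz' : ∀ k ∈ Finset.range N, z ∉ A k := by simpa [B] using hz
      rw [Finset.sum_eq_zero fun k hk => by simp [hz' k hk], sub_zero]
      simp only [Set.indicator_of_mem (Set.mem_compl hz)]
      linarith [hFG i z]

theorem ae_tendstoUniformly_empiricalMean_of_equicontinuous [TopologicalSpace Z]
    [LindelofSpace Z] [OpensMeasurableSpace Z] [IsProbabilityMeasure P] {F : ι → Z → ℝ}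
    {G : Z → ℝ} (hlaw : ∀ i, HasLaw (D i) ν P) (hindep : Pairwise fun i j => D i ⟂ᵢ[P] D j)
    (hF : Equicontinuous F) (hG : Integrable G ν) (hFG : ∀ i z, |F i z| ≤ G z) :
    ∀ᵐ ω ∂P, TendstoUniformly (fun n i => empiricalMean (sample D n ω) (F i))
      (fun i => ∫ z, F i z ∂ν) atTop := by
  have : Nonempty Z := (nonempty_of_isProbabilityMeasure P).map (D 0)
  have : IsProbabilityMeasure ν := (hlaw 0).isProbabilityMeasure_iff.1 ‹_›
  obtain ⟨u, -, hu_pos, hu_lim⟩ := exists_seq_strictAnti_tendsto (0 : ℝ)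
  choose A c N b hA hb hb_lt happrox using fun m =>
    exists_sum_indicator_approx_of_equicontinuous hF hG hFG (hu_pos m)
  have hA_int (m k : ℕ) : Integrable ((A m k).indicator (1 : Z → ℝ)) ν :=
    (integrable_const 1).indicator (hA m k)
  have hslln_b := ae_all_iff.2 fun m => ae_tendsto_empiricalMean_sample hlaw hindep (hb m)
  have hslln_A := ae_all_iff.2 fun m => ae_all_iff.2 fun k =>
    ae_tendsto_empiricalMean_sample hlaw hindep (hA_int m k)
  filter_upwards [hslln_b, hslln_A] with ω hω_b hω_A
  rw [Metric.tendstoUniformly_iff]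
  intro ε hε
  obtain ⟨m, hm⟩ := (hu_lim.eventually_lt_const (half_pos hε)).exists
  have hbound_lim : Tendsto (fun n => empiricalMean (sample D n ω) (b m) + ∫ z, b m z ∂ν
      + ∑ k ∈ Finset.range (N m), G (c m k) * |empiricalMean (sample D n ω)
        ((A m k).indicator 1) - ∫ z, (A m k).indicator 1 z ∂ν|) atTop
      (𝓝 (∫ z, b m z ∂ν + ∫ z, b m z ∂ν + 0)) := by
    refine ((hω_b m).add_const _).add ?_
    rw [← Finset.sum_const_zero (s := Finset.range (N m))]
    refine tendsto_finsetSum _ fun k _ => ?_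
    simpa using ((tendsto_sub_nhds_zero_iff.2 (hω_A m k)).abs).const_mul (G (c m k))
  filter_upwards [hbound_lim.eventually_lt_const (u := ε) (by linarith [hb_lt m])] with n hn i
  have hF_int : Integrable (F i) ν :=
    hG.mono' (hF.continuous i).measurable.aestronglyMeasurable (.of_forall (hFG i))
  rw [dist_comm, Real.dist_eq]
  refine (abs_empiricalMean_sub_integral_le hF_int (fun k _ => hA_int m k) (hb m)
    (happrox m i) _).trans_lt (lt_of_le_of_lt ?_ hn)
  gcongr
  exact hFG i _

end UniformStrongLaw

theorem exists_abs_sub_le_add_mul_dist_sq {ι X : Type*} [PseudoMetricSpace X] {F : ι → X → ℝ}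
    {R : ℝ} (hF : UniformEquicontinuous F) (hR : ∀ i x, |F i x| ≤ R) {ε : ℝ} (hε : 0 < ε) :
    ∃ C, 0 ≤ C ∧ ∀ i x y, |F i x - F i y| ≤ ε + C * dist x y ^ 2 := by
  obtain ⟨δ, hδ, hFδ⟩ := Metric.uniformEquicontinuous_iff.1 hF ε hε
  refine ⟨2 * |R| / δ ^ 2, by positivity, fun i x y => ?_⟩
  rcases lt_or_ge (dist x y) δ with hxy | hxy
  · exact (hFδ x y hxy i).le.trans (le_add_of_nonneg_right (by positivity))
  · have hfar : 1 ≤ dist x y ^ 2 / δ ^ 2 := (one_le_div (by positivity)).2 (by gcongr)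
    calc |F i x - F i y| ≤ |F i x| + |F i y| := abs_sub _ _
      _ ≤ 2 * |R| * 1 := by linarith [hR i x, hR i y, le_abs_self R]
      _ ≤ 2 * |R| * (dist x y ^ 2 / δ ^ 2) := by gcongr
      _ ≤ ε + 2 * |R| / δ ^ 2 * dist x y ^ 2 := by
        rw [div_mul_eq_mul_div, mul_div_assoc]
        exact le_add_of_nonneg_left hε.le

section Gaussian

variable {d : ℕ} {m : Feature d} {S : Matrix (Fin d) (Fin d) ℝ}

theorem integral_norm_sub_sq_multivariateGaussian (hS : S.PosSemidef) :
    ∫ x, ‖x - m‖ ^ 2 ∂(multivariateGaussian m S) = S.trace := by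
  have hmem : MemLp (fun x : Feature d => x - m) 2 (multivariateGaussian m S) :=
    IsGaussian.memLp_two_id.sub (memLp_const m)
  have hmean (i : Fin d) : ∫ x, x i ∂(multivariateGaussian m S) = m i := by
    simpa using (EuclideanSpace.proj (𝕜 := ℝ) i).integral_comp_comm
      (IsGaussian.integrable_id (μ := multivariateGaussian m S))
  have hvar (i : Fin d) : ∫ x, (x i - m i) ^ 2 ∂(multivariateGaussian m S) = S i i := by
    rw [← variance_eval_multivariateGaussian (μ := m) hS i,
      variance_eq_integral (Measurable.aemeasurable (by fun_prop)), hmean]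
  simp only [EuclideanSpace.real_norm_sq_eq, PiLp.sub_apply]
  rw [integral_finsetSum]
  · simp only [hvar, Matrix.trace, Matrix.diag_apply]
  · exact fun i _ => ((EuclideanSpace.proj (𝕜 := ℝ) i).comp_memLp' hmem).integrable_sq

theorem abs_integral_multivariateGaussian_sub_le (hS : S.PosSemidef) {f : Feature d → ℝ}
    {a b : ℝ} (hf : Measurable f) (hfm : ∀ x, |f x - f m| ≤ a + b * dist x m ^ 2) :
    |∫ x, f x ∂(multivariateGaussian m S) - f m| ≤ a + b * S.trace := by
  have hsq : Integrable (fun x : Feature d => b * ‖x - m‖ ^ 2) (multivariateGaussian m S) :=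
    ((IsGaussian.memLp_two_id.sub (memLp_const m)).integrable_norm_pow two_ne_zero).const_mul b
  have hdom : Integrable (fun x : Feature d => a + b * ‖x - m‖ ^ 2)
      (multivariateGaussian m S) := (integrable_const a).add hsq
  have hfm' : ∀ x, ‖f x - f m‖ ≤ a + b * ‖x - m‖ ^ 2 := by
    simpa only [dist_eq_norm, Real.norm_eq_abs] using hfm
  have hdiff : Integrable (fun x => f x - f m) (multivariateGaussian m S) :=
    hdom.mono' (hf.sub_const _).aestronglyMeasurable (.of_forall hfm')
  have hf_int : Integrable f (multivariateGaussian m S) := by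
    simpa only [Pi.add_def, sub_add_cancel] using hdiff.add (integrable_const (f m))
  calc |∫ x, f x ∂(multivariateGaussian m S) - f m|
      = ‖∫ x, (f x - f m) ∂(multivariateGaussian m S)‖ := by
        rw [integral_sub hf_int (integrable_const _)]; simp
    _ ≤ ∫ x, (a + b * ‖x - m‖ ^ 2) ∂(multivariateGaussian m S) :=
        norm_integral_le_of_norm_le hdom (.of_forall hfm')
    _ = a + b * S.trace := by
        rw [integral_add (integrable_const a) hsq, integral_const_mul,
          integral_norm_sub_sq_multivariateGaussian hS]
        simp

end Gaussian

section QuadraticLoss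

variable {d : ℕ} {𝒴 : Set ℝ} {H : Set (Feature d → ℝ)} {R : ℝ}

theorem abs_sub_prediction_le (h𝒴 : ∀ y ∈ 𝒴, |y| ≤ R) (hH : ∀ ψ ∈ H, ∀ x, ψ x ∈ 𝒴)
    (z : DataPoint d 𝒴) (ψ : H) : |(z.2 : ℝ) - ψ.1 z.1| ≤ 2 * R := by
  linarith [abs_sub (z.2 : ℝ) (ψ.1 z.1), h𝒴 _ z.2.2, h𝒴 _ (hH ψ.1 ψ.2 z.1)]

theorem abs_quadraticLoss_le (h𝒴 : ∀ y ∈ 𝒴, |y| ≤ R) (hH : ∀ ψ ∈ H, ∀ x, ψ x ∈ 𝒴)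
    (z : DataPoint d 𝒴) (ψ : H) : |quadraticLoss 𝒴 H z ψ| ≤ (2 * R) ^ 2 := by
  rw [quadraticLoss, abs_pow]
  gcongr
  exact abs_sub_prediction_le h𝒴 hH z ψ

theorem abs_quadraticLoss_sub_le (h𝒴 : ∀ y ∈ 𝒴, |y| ≤ R) (hH : ∀ ψ ∈ H, ∀ x, ψ x ∈ 𝒴)
    (z w : DataPoint d 𝒴) (ψ : H) :
    |quadraticLoss 𝒴 H z ψ - quadraticLoss 𝒴 H w ψ|
      ≤ 4 * R * (dist z.2 w.2 + |ψ.1 z.1 - ψ.1 w.1|) := by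
  have hsum : |(z.2 - ψ.1 z.1) + (w.2 - ψ.1 w.1)| ≤ 4 * R := by
    linarith [abs_add_le (z.2 - ψ.1 z.1) (w.2 - ψ.1 w.1), abs_sub_prediction_le h𝒴 hH z ψ,
      abs_sub_prediction_le h𝒴 hH w ψ]
  have hdiff : |(z.2 - ψ.1 z.1) - (w.2 - ψ.1 w.1)| ≤ dist z.2 w.2 + |ψ.1 z.1 - ψ.1 w.1| := by
    rw [sub_sub_sub_comm, Subtype.dist_eq, Real.dist_eq]
    exact abs_sub _ _
  rw [quadraticLoss, quadraticLoss, sq_sub_sq, abs_mul]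
  exact mul_le_mul hsum hdiff (abs_nonneg _) ((abs_nonneg _).trans hsum)

theorem equicontinuous_quadraticLoss (h𝒴 : ∀ y ∈ 𝒴, |y| ≤ R) (hH : ∀ ψ ∈ H, ∀ x, ψ x ∈ 𝒴)
    (hequi : H.Equicontinuous) :
    Equicontinuous fun (ψ : H) (z : DataPoint d 𝒴) => quadraticLoss 𝒴 H z ψ := by
  intro z₀
  refine Metric.equicontinuousAt_iff_right.2 fun ε hε => ?_
  obtain ⟨η, hη, hηε⟩ := exists_pos_mul_lt hε (4 * R * 2)
  have hR : 0 ≤ R := (abs_nonneg _).trans (h𝒴 _ z₀.2.2)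
  have hψ : ∀ᶠ z : DataPoint d 𝒴 in 𝓝 z₀, ∀ ψ : H, dist (ψ.1 z₀.1) (ψ.1 z.1) < η :=
    continuousAt_fst.eventually (Metric.equicontinuousAt_iff_right.1 (hequi z₀.1) η hη)
  have hy : ∀ᶠ z : DataPoint d 𝒴 in 𝓝 z₀, dist z₀.2 z.2 < η := by
    simp only [dist_comm z₀.2]
    exact continuousAt_snd.eventually (Metric.ball_mem_nhds _ hη)
  filter_upwards [hψ, hy] with z hzψ hzy ψ
  calc dist (quadraticLoss 𝒴 H z₀ ψ) (quadraticLoss 𝒴 H z ψ)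
      ≤ 4 * R * (dist z₀.2 z.2 + |ψ.1 z₀.1 - ψ.1 z.1|) := abs_quadraticLoss_sub_le h𝒴 hH z₀ z ψ
    _ ≤ 4 * R * (η + η) := by gcongr; exact (hzψ ψ).le
    _ < ε := by linarith

theorem ae_tendstoUniformly_empiricalMean_quadraticLoss {Ω : Type*} [MeasurableSpace Ω]
    {P : Measure Ω} [IsProbabilityMeasure P] {ν : Measure (DataPoint d 𝒴)}
    {D : ℕ → Ω → DataPoint d 𝒴} (hlaw : ∀ i, HasLaw (D i) ν P)
    (hindep : Pairwise fun i j => D i ⟂ᵢ[P] D j) (h𝒴 : ∀ y ∈ 𝒴, |y| ≤ R)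
    (hH : ∀ ψ ∈ H, ∀ x, ψ x ∈ 𝒴) (hequi : H.Equicontinuous) :
    ∀ᵐ ω ∂P, TendstoUniformly
      (fun n (ψ : H) => empiricalMean (sample D n ω) fun z => quadraticLoss 𝒴 H z ψ)
      (predictionError ν) atTop := by
  have : IsProbabilityMeasure ν := (hlaw 0).isProbabilityMeasure_iff.1 ‹_›
  exact ae_tendstoUniformly_empiricalMean_of_equicontinuous hlaw hindep
    (equicontinuous_quadraticLoss h𝒴 hH hequi) (integrable_const _)
    fun ψ z => abs_quadraticLoss_le h𝒴 hH z ψ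

end QuadraticLoss

section GaussianBolstering

variable {d : ℕ} {𝒴 : Set ℝ} {H : Set (Feature d → ℝ)} {R : ℝ} {K : KernelFamily 𝒴 H}

theorem gaussianBolstering_eq_empiricalMean (K : KernelFamily 𝒴 H) {n : ℕ}
    (S : Fin n → DataPoint d 𝒴) (ψ : H) :
    gaussianBolstering K S ψ = empiricalMean S fun z =>
      ∫ x, quadraticLoss 𝒴 H (x, z.2) ψ ∂(multivariateGaussian z.1 (K n S z.1 z.2 ψ)) := by
  simp only [gaussianBolstering, empiricalMean, quadraticLoss, one_div, inv_mul_eq_div,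
    sub_sq_comm]

theorem abs_integral_quadraticLoss_sub_le (h𝒴 : ∀ y ∈ 𝒴, |y| ≤ R) (hH : ∀ ψ ∈ H, ∀ x, ψ x ∈ 𝒴)
    (z : DataPoint d 𝒴) {ψ : H} (hψ_meas : Measurable ψ.1) {a b : ℝ}
    (hψ : ∀ x m, |ψ.1 x - ψ.1 m| ≤ a + b * dist x m ^ 2) {A : Matrix (Fin d) (Fin d) ℝ}
    (hA : A.PosSemidef) :
    |∫ x, quadraticLoss 𝒴 H (x, z.2) ψ ∂(multivariateGaussian z.1 A) - quadraticLoss 𝒴 H z ψ|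
      ≤ 4 * R * (a + b * A.trace) := by
  have hR : 0 ≤ R := (abs_nonneg _).trans (h𝒴 _ z.2.2)
  have hmeas : Measurable fun x => quadraticLoss 𝒴 H (x, z.2) ψ := by
    unfold quadraticLoss
    fun_prop
  have hmod (x : Feature d) : |quadraticLoss 𝒴 H (x, z.2) ψ - quadraticLoss 𝒴 H z ψ|
      ≤ 4 * R * a + 4 * R * b * dist x z.1 ^ 2 :=
    calc |quadraticLoss 𝒴 H (x, z.2) ψ - quadraticLoss 𝒴 H z ψ|
        ≤ 4 * R * (dist z.2 z.2 + |ψ.1 x - ψ.1 z.1|) :=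
          abs_quadraticLoss_sub_le h𝒴 hH (x, z.2) z ψ
      _ ≤ 4 * R * (0 + (a + b * dist x z.1 ^ 2)) := by
          rw [dist_self]
          gcongr
          exact hψ x z.1
      _ = 4 * R * a + 4 * R * b * dist x z.1 ^ 2 := by ring
  calc _ ≤ 4 * R * a + 4 * R * b * A.trace :=
        abs_integral_multivariateGaussian_sub_le hA hmeas hmod
    _ = 4 * R * (a + b * A.trace) := by ring

theorem abs_gaussianBolstering_sub_empiricalMean_le (h𝒴 : ∀ y ∈ 𝒴, |y| ≤ R)
    (hH : ∀ ψ ∈ H, ∀ x, ψ x ∈ 𝒴) {n : ℕ} {S : Fin n → DataPoint d 𝒴} {ψ : H}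
    (hK : ∀ x y, (K n S x y ψ).PosSemidef) (hψ_meas : Measurable ψ.1) {a b T : ℝ} (hb : 0 ≤ b)
    (hψ : ∀ x m, |ψ.1 x - ψ.1 m| ≤ a + b * dist x m ^ 2)
    (hT : ∀ x y, (K n S x y ψ).trace ≤ T) :
    |gaussianBolstering K S ψ - empiricalMean S fun z => quadraticLoss 𝒴 H z ψ|
      ≤ 4 * R * (a + b * T) := by
  have hR : 0 ≤ R := (abs_nonneg _).trans (h𝒴 _ (hH ψ.1 ψ.2 0))
  have hpoint (z : DataPoint d 𝒴) :
      |∫ x, quadraticLoss 𝒴 H (x, z.2) ψ ∂(multivariateGaussian z.1 (K n S z.1 z.2 ψ))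
        - quadraticLoss 𝒴 H z ψ| ≤ 4 * R * (a + b * T) :=
    (abs_integral_quadraticLoss_sub_le h𝒴 hH z hψ_meas hψ (hK z.1 z.2)).trans
      (by gcongr; exact hT z.1 z.2)
  have hbound_nonneg : 0 ≤ 4 * R * (a + b * T) :=
    (abs_nonneg _).trans (hpoint (0, ⟨ψ.1 0, hH ψ.1 ψ.2 0⟩))
  rw [gaussianBolstering_eq_empiricalMean]
  exact (abs_empiricalMean_sub_le S hpoint).trans
    (empiricalMean_le S hbound_nonneg fun _ => le_rfl)

theorem eventually_trace_le {S : (n : ℕ) → Fin n → DataPoint d 𝒴}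
    (hK0 : ∀ j, Tendsto (fun n => ⨆ (x : Feature d) (y : 𝒴) (ψ : H),
      ENNReal.ofReal (K n (S n) x y ψ j j)) atTop (𝓝 0)) {ε : ℝ} (hε : 0 < ε) :
    ∀ᶠ n in atTop, ∀ x y ψ, (K n (S n) x y ψ).trace ≤ ε := by
  have hsum := tendsto_finsetSum Finset.univ fun j _ => hK0 j
  rw [Finset.sum_const_zero] at hsum
  filter_upwards [hsum.eventually_lt_const (ENNReal.ofReal_pos.2 hε)] with n hn x y ψ
  have htrace : ENNReal.ofReal (K n (S n) x y ψ).trace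
      ≤ ∑ j, ENNReal.ofReal (K n (S n) x y ψ j j) :=
    Finset.le_sum_of_subadditive _ ENNReal.ofReal_zero.le (fun _ _ => ENNReal.ofReal_add_le) _ _
  refine (ENNReal.ofReal_le_ofReal_iff hε.le).1
    (htrace.trans ((Finset.sum_le_sum fun j _ => ?_).trans hn.le))
  exact le_iSup_of_le x (le_iSup_of_le y (le_iSup_of_le ψ le_rfl))

theorem tendstoUniformly_gaussianBolstering_sub_empiricalMean (h𝒴 : ∀ y ∈ 𝒴, |y| ≤ R)
    (hH : ∀ ψ ∈ H, ∀ x, ψ x ∈ 𝒴) (hequi : H.UniformEquicontinuous)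
    {S : (n : ℕ) → Fin n → DataPoint d 𝒴}
    (hK : ∀ n x y ψ, (K n (S n) x y ψ).PosSemidef)
    (hK0 : ∀ j, Tendsto (fun n => ⨆ (x : Feature d) (y : 𝒴) (ψ : H),
      ENNReal.ofReal (K n (S n) x y ψ j j)) atTop (𝓝 0)) :
    TendstoUniformly
      (fun n ψ => gaussianBolstering K (S n) ψ
        - empiricalMean (S n) fun z => quadraticLoss 𝒴 H z ψ) 0 atTop := by
  refine Metric.tendstoUniformly_iff.2 fun ε hε => ?_
  obtain ⟨a, ha, haε⟩ := exists_pos_mul_lt hε (4 * R * 2)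
  obtain ⟨b, hb, hmod⟩ :=
    exists_abs_sub_le_add_mul_dist_sq hequi (fun ψ x => h𝒴 _ (hH ψ.1 ψ.2 x)) ha
  obtain ⟨T, hT, hTa⟩ := exists_pos_mul_lt ha b
  filter_upwards [eventually_trace_le hK0 hT] with n hn ψ
  have hR : 0 ≤ R := (abs_nonneg _).trans (h𝒴 _ (hH ψ.1 ψ.2 0))
  rw [dist_comm, Real.dist_eq, Pi.zero_apply, sub_zero]
  calc |gaussianBolstering K (S n) ψ - empiricalMean (S n) fun z => quadraticLoss 𝒴 H z ψ|
      ≤ 4 * R * (a + b * T) :=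
        abs_gaussianBolstering_sub_empiricalMean_le h𝒴 hH (hK n · · ψ)
          (hequi.uniformContinuous ψ).continuous.measurable hb (hmod ψ) (hn · · ψ)
    _ ≤ 4 * R * (a + a) := by gcongr
    _ < ε := by linarith

end GaussianBolstering

theorem lipschitzWith_of_abs_partialDeriv_le {d : ℕ} {f : Feature d → ℝ} {C : Fin d → ℝ≥0}
    (hf : Differentiable ℝ f) (hC : ∀ i x, |partialDeriv i f x| ≤ C i) :
    LipschitzWith (∑ i, C i) f := by
  refine lipschitzWith_of_nnnorm_fderiv_le hf fun x => ?_
  rw [← NNReal.coe_le_coe, coe_nnnorm]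
  refine ContinuousLinearMap.opNorm_le_bound _ (NNReal.coe_nonneg _) fun v => ?_
  have hv : fderiv ℝ f x v = ∑ i, v i * partialDeriv i f x := by
    conv_lhs => rw [← (EuclideanSpace.basisFun (Fin d) ℝ).sum_repr v]
    simp [partialDeriv]
  rw [hv, NNReal.coe_sum, Finset.sum_mul]
  refine (norm_sum_le _ _).trans (Finset.sum_le_sum fun i _ => ?_)
  rw [norm_mul, mul_comm]
  gcongr
  · exact hC i x
  · exact PiLp.norm_apply_le v i

theorem uniformEquicontinuous_of_abs_partialDeriv_le {d : ℕ} {H : Set (Feature d → ℝ)}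
    (hH : ∀ ψ ∈ H, Differentiable ℝ ψ)
    (hderiv : ∀ i, ∃ C : ℝ, ∀ ψ ∈ H, ∀ x, |partialDeriv i ψ x| ≤ C) :
    H.UniformEquicontinuous := by
  choose C hC using hderiv
  exact LipschitzWith.uniformEquicontinuous _ (∑ i, (C i).toNNReal) fun ψ =>
    lipschitzWith_of_abs_partialDeriv_le (hH ψ.1 ψ.2) fun i x =>
      (hC i ψ.1 ψ.2 x).trans (Real.le_coe_toNNReal (C i))

end Bolstering

open Bolstering in
theorem proposition9_general {Ω : Type*} [MeasurableSpace Ω] (P : Measure Ω)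
    [IsProbabilityMeasure P] {d : ℕ} (𝒴 : Set ℝ) (h𝒴 : Bornology.IsBounded 𝒴)
    (H : Set (Feature d → ℝ)) (hH : ∀ ψ ∈ H, ∀ x, ψ x ∈ 𝒴) (hequi : H.UniformEquicontinuous)
    (ν : Measure (DataPoint d 𝒴)) (D : ℕ → Ω → DataPoint d 𝒴) (hlaw : ∀ i, HasLaw (D i) ν P)
    (hindep : Pairwise fun i j => D i ⟂ᵢ[P] D j) (Ψ : PredictionRule 𝒴 H)
    (K : KernelFamily 𝒴 H) (hK : ∀ n S x y ψ, (K n S x y ψ).PosSemidef)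
    (hK0 : ∀ᵐ ω ∂P, ∀ j : Fin d, Tendsto (fun n => ⨆ (x : Feature d) (y : 𝒴) (ψ : H),
      ENNReal.ofReal (K n (sample D n ω) x y ψ j j)) atTop (𝓝 0)) :
    IsConsistent P (fun n ω => gaussianBolstering K (sample D n ω) (Ψ n (sample D n ω)))
      (fun n ω => predictionError ν (Ψ n (sample D n ω))) := by
  obtain ⟨R, hR⟩ := h𝒴.exists_norm_le
  filter_upwards [hK0, ae_tendstoUniformly_empiricalMean_quadraticLoss hlaw hindep hR hH
    hequi.equicontinuous] with ω hKω hlln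
  have hbias := tendstoUniformly_gaussianBolstering_sub_empiricalMean hR hH hequi
    (fun n => hK n (sample D n ω)) hKω
  have hunif : TendstoUniformly (fun n => gaussianBolstering K (sample D n ω))
      (predictionError ν) atTop := by
    simpa only [Pi.add_def, Pi.zero_apply, zero_add, sub_add_cancel] using hbias.add hlln
  refine Metric.tendsto_nhds.2 fun ε hε => ?_
  filter_upwards [Metric.tendstoUniformly_iff.1 hunif ε hε] with n hn
  rw [Real.dist_0_eq_abs, abs_abs, abs_sub_comm]
  exact hn (Ψ n (sample D n ω))

theorem proposition9 {Ω : Type*} [MeasurableSpace Ω] (P : Measure Ω) [IsProbabilityMeasure P]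
    {d : ℕ} (𝒴 : Set ℝ) (h𝒴 : IsCompact 𝒴)
    -- the hypothesis space `H ⊂ C²(ℝ^d, 𝒴)`
    (H : Set (Bolstering.Feature d → ℝ))
    (hH : ∀ ψ ∈ H, ContDiff ℝ 2 ψ ∧ ∀ x, ψ x ∈ 𝒴)
    (hVC : Bolstering.vcDimLoss (Bolstering.quadraticLoss 𝒴 H) < ⊤)
    (hderiv : ∀ i : Fin d, ∃ C : ℝ, ∀ ψ ∈ H, ∀ x, |Bolstering.partialDeriv i ψ x| ≤ C)
    (hderiv2 : ∀ i j : Fin d, ∃ C : ℝ, ∀ ψ ∈ H, ∀ x,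
      |Bolstering.partialDeriv i (Bolstering.partialDeriv j ψ) x| ≤ C)
    -- the i.i.d. data with law `ν`
    (ν : Measure (Bolstering.DataPoint d 𝒴)) (D : ℕ → Ω → Bolstering.DataPoint d 𝒴)
    (hlaw : ∀ i, HasLaw (D i) ν P) (hindep : iIndepFun D P)
    -- the prediction rule and the covariance matrices
    (Ψ : Bolstering.PredictionRule 𝒴 H) (K : Bolstering.KernelFamily 𝒴 H)
    (hK : ∀ n S x y ψ, (K n S x y ψ).PosSemidef)
    (hK0 : ∀ᵐ ω ∂P, ∀ j : Fin d,
      Tendsto (fun n => ⨆ (x : Bolstering.Feature d) (y : 𝒴) (ψ : H),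
        ENNReal.ofReal (K n (Bolstering.sample D n ω) x y ψ j j)) atTop (𝓝 0)) :
    Bolstering.IsConsistent P
      (fun n ω => Bolstering.gaussianBolstering K (Bolstering.sample D n ω)
        (Ψ n (Bolstering.sample D n ω)))
      (fun n ω => Bolstering.predictionError ν (Ψ n (Bolstering.sample D n ω))) :=
  proposition9_general P 𝒴 h𝒴.isBounded H (fun ψ hψ => (hH ψ hψ).2)
    (Bolstering.uniformEquicontinuous_of_abs_partialDeriv_le
      (fun ψ hψ => (hH ψ hψ).1.differentiable two_ne_zero) hderiv)
    ν D hlaw (fun _ _ hij => hindep.indepFun hij) Ψ K hK hK0
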